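/- Regard $\mathbb Z^2$ as an infinite graph in which two points are adjacent when they are at distance $1$. For integers $M,N\ge 1$, let $\mathcal R(M,N)$ be the subgraph of $\mathbb Z^2$ induced by the points $(x,y)$ with $$y\le x\le y+M-1\quad\text{and}\quad -y\le x\le -y+N-1,$$ and let $\tilde{\mathcal R}(M,N)$ be the subgraph induced by the points $(x,y)$ with $$y\le x\le y+M-1\quad\text{and}\quad -y+1\le x\le -y+N.$$ For a finite graph $G$, let $\Sigma(G)$ be its independence complex, that is, the simplicial complex formed by the independent sets of $G$ (topological statements refer to its geometric realization), and let $Z_G=\sum_{I}(-1)^{|I|}$, where the sum runs over all independent sets $I$ of $G$, including $\emptyset$. Let $M,N\ge 1$, $m=\lceil M/3\rceil$ and $n=\lceil N/3\rceil$. Let $G$ be either $\mathcal R(M,N)$, or $\tilde{\mathcal R}(M,N)$ with $(M,N)\ne(1,1)$ (the graph $\tilde{\mathcal R}(1,1)$ has no vertices). - If $M\equiv 1\pmod 3$ or $N\equiv 1\pmod 3$, then $\Sigma(G)$ is contractible and $Z_G=0$. - Otherwise, $\Sigma(G)$ is homotopy equivalent to a sphere of dimension $mn-1$, and $Z_G=(-1)^{mn}$.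 -/

import Mathlib

namespace HardSquares

/-- The square lattice `ℤ²` as an infinite graph: two points are joined when their distance
is `1`. -/
def squareLattice : SimpleGraph (ℤ × ℤ) where
  Adj p q := |p.1 - q.1| + |p.2 - q.2| = 1
  symm := ⟨fun p q h => by
    rw [abs_sub_comm q.1, abs_sub_comm q.2]
    exact h⟩
  loopless := ⟨fun p h => by simp at h⟩

/-- The vertex set of the tilted rectangle `R(M,N)`. -/
def rectVerts (M N : ℕ) : Set (ℤ × ℤ) :=
  {p | p.2 ≤ p.1 ∧ p.1 ≤ p.2 + M - 1 ∧ -p.2 ≤ p.1 ∧ p.1 ≤ -p.2 + N - 1}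

/-- The vertex set of the tilted rectangle `R̃(M,N)`. -/
def rectTildeVerts (M N : ℕ) : Set (ℤ × ℤ) :=
  {p | p.2 ≤ p.1 ∧ p.1 ≤ p.2 + M - 1 ∧ -p.2 + 1 ≤ p.1 ∧ p.1 ≤ -p.2 + N}

theorem rectVerts_finite (M N : ℕ) : (rectVerts M N).Finite := by
  refine (Set.finite_Icc ((-M - N : ℤ), (-M - N : ℤ)) ((M + N : ℤ), (M + N : ℤ))).subset ?_
  rintro ⟨x, y⟩ ⟨h1, h2, h3, h4⟩
  simp only [Set.mem_Icc, Prod.mk_le_mk] at *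
  omega

theorem rectTildeVerts_finite (M N : ℕ) : (rectTildeVerts M N).Finite := by
  refine (Set.finite_Icc ((-M - N : ℤ), (-M - N : ℤ)) ((M + N : ℤ), (M + N : ℤ))).subset ?_
  rintro ⟨x, y⟩ ⟨h1, h2, h3, h4⟩
  simp only [Set.mem_Icc, Prod.mk_le_mk] at *
  omega

noncomputable instance (M N : ℕ) : Fintype (rectVerts M N) := (rectVerts_finite M N).fintype

noncomputable instance (M N : ℕ) : Fintype (rectTildeVerts M N) :=
  (rectTildeVerts_finite M N).fintype

/-- The tilted rectangle `R(M,N)`, an induced subgraph of the square lattice. -/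
def rect (M N : ℕ) : SimpleGraph (rectVerts M N) := squareLattice.induce (rectVerts M N)

/-- The tilted rectangle `R̃(M,N)`, an induced subgraph of the square lattice. -/
def rectTilde (M N : ℕ) : SimpleGraph (rectTildeVerts M N) :=
  squareLattice.induce (rectTildeVerts M N)

/-- The independence complex `Σ(G)`: its faces are the independent sets of `G`. As usual in
Mathlib, the empty face is left implicit; this does not affect the geometric realization. -/
def indepComplex {V : Type*} (G : SimpleGraph V) : AbstractSimplicialComplex V where
  faces := {s | s.Nonempty ∧ G.IsIndepSet (s : Set V)}
  isRelLowerSet_faces := fun _ hs =>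
    ⟨hs.1, fun _ hts ht => ⟨ht, hs.2.mono (Finset.coe_subset.2 hts)⟩⟩
  singleton_mem := fun v => ⟨Finset.singleton_nonempty v, by simp [SimpleGraph.IsIndepSet]⟩

/-- The geometric realization of a simplicial complex on a finite vertex set: the points of the
standard simplex whose support lies in a face, with the topology induced from `V → ℝ`. -/
def realization {V : Type*} [Fintype V] (K : AbstractSimplicialComplex V) : Set (V → ℝ) :=
  {w | w ∈ stdSimplex ℝ V ∧ ∃ s ∈ K, ∀ v, v ∉ s → w v = 0}

open Classical in
/-- The partition function `Z_G(u) = ∑_I u ^ |I|` of the hard-particle model on `G`, the sum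
being over all independent sets of `G`, the empty one included. -/
noncomputable def partitionFunction {V : Type*} [Fintype V] (G : SimpleGraph V) (u : ℤ) : ℤ :=
  ∑ I ∈ (Finset.univ : Finset (Finset V)).filter (fun I : Finset V => G.IsIndepSet (I : Set V)),
    u ^ I.card

/-- The alternating number of independent sets of `G`, `Z_G(-1) = ∑_I (-1) ^ |I|`. -/
noncomputable def alternatingNumber {V : Type*} [Fintype V] (G : SimpleGraph V) : ℤ :=
  partitionFunction G (-1)

end HardSquares

/-! In the diagonal coordinates `a = x - y` and `b = x + y - e` (`e = 0` for `R`, `e = 1` for `R̃`)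
the graph consists of the points of the box `0 ≤ a < M`, `0 ≤ b < N` with `a + b + e` even, and an
edge changes each coordinate by `±1`.

The fold lemma `homotopyEquiv_erase` deletes a vertex `v` whose neighbourhood contains that of
another vertex `u`: pushing the weight of `v` onto `u` is a deformation retraction. With a suitable
order, folds remove every vertex having `a` or `b` congruent to `2` modulo `3` (`fold_rectangle`).
The survivors sit in the lower 2×2 corners of the 3×3 blocks. A complete corner contains just two
vertices of the right parity, on one of its diagonals, and they are adjacent; distinct corners are
not joined by edges.

If `M` or `N` is `1` modulo `3`, the last row or column of blocks is cut after residue `0`, so some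
survivor is isolated and the complex is a cone (`exists_isolated_kept`). Otherwise all `mn` corners
are complete and the survivors form a matching of `mn` edges. Its independence complex is the join
of `mn` copies of `S⁰`, the boundary of a cross-polytope, hence a sphere of dimension `mn - 1`
(`matching_kept`).

The alternating number is carried through the same folds by the deletion recursion `altNum_eq_sub`.
-/

open scoped ContinuousMap

namespace HardSquares

/-! ### Cones, folds and the deletion recursion -/

section General

variable {V : Type*}

/-- The geometric realization of the independence complex of the subgraph of `G` induced by the
finite set `S`, as a set of functions on all the vertices of `G`. -/
def indepSpace (G : SimpleGraph V) (S : Finset V) : Set (V → ℝ) :=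
  {w | (∀ v, 0 ≤ w v) ∧ (∀ v, v ∉ S → w v = 0) ∧ ∑ v ∈ S, w v = 1 ∧
    ∀ u v, G.Adj u v → w u = 0 ∨ w v = 0}

open Classical in
/-- The alternating number of independent subsets of `S`. -/
noncomputable def altNum (G : SimpleGraph V) (S : Finset V) : ℤ :=
  ∑ I ∈ S.powerset, if G.IsIndepSet (I : Set V) then (-1) ^ I.card else 0

theorem homotopic_of_segment_subset {Y E : Type*} [TopologicalSpace Y] [AddCommGroup E]
    [Module ℝ E] [TopologicalSpace E] [ContinuousAdd E] [ContinuousSMul ℝ E] {X : Set E}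
    (f g : C(Y, X)) (h : ∀ y, segment ℝ (f y : E) (g y) ⊆ X) : f.Homotopic g :=
  ⟨{ toFun := fun p => ⟨(1 - (p.1 : ℝ)) • (f p.2 : E) + (p.1 : ℝ) • (g p.2 : E),
        h p.2 ⟨1 - p.1, p.1, sub_nonneg.2 p.1.2.2, p.1.2.1, by ring, rfl⟩⟩
     continuous_toFun := by fun_prop
     map_zero_left := fun y => by ext; simp
     map_one_left := fun y => by ext; simp }⟩

/-- Independence is tested on pairs, so the complex is flag: the edgewise condition says that the
two supports together form an independent set. Both points then lie in one closed simplex, which is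
convex. -/
theorem segment_subset_indepSpace {G : SimpleGraph V} {S : Finset V} {w w' : V → ℝ}
    (hw : w ∈ indepSpace G S) (hw' : w' ∈ indepSpace G S)
    (h : ∀ x y, G.Adj x y → (w x = 0 ∧ w' x = 0) ∨ (w y = 0 ∧ w' y = 0)) :
    segment ℝ w w' ⊆ indepSpace G S := by
  rintro _ ⟨s, t, hs, ht, hst, rfl⟩
  refine ⟨fun v => ?_, fun v hv => ?_, ?_, fun x y hxy => ?_⟩
  · have := hw.1 v
    have := hw'.1 v
    simp only [Pi.add_apply, Pi.smul_apply, smul_eq_mul]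
    positivity
  · simp [hw.2.1 v hv, hw'.2.1 v hv]
  · simp [Finset.sum_add_distrib, ← Finset.mul_sum, hw.2.2.1, hw'.2.2.1, hst]
  · rcases h x y hxy with ⟨h1, h2⟩ | ⟨h1, h2⟩
    · left; simp [h1, h2]
    · right; simp [h1, h2]

/-- An isolated vertex can be added to every face, so the complex is a cone with apex `a`; the
contraction is the straight line to the apex. -/
theorem contractibleSpace_indepSpace [DecidableEq V] {G : SimpleGraph V} {S : Finset V} {a : V}
    (ha : a ∈ S) (h : ∀ x ∈ S, ¬ G.Adj a x) : ContractibleSpace (indepSpace G S) := by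
  have hmem : Pi.single a (1 : ℝ) ∈ indepSpace G S := by
    refine ⟨fun v => ?_, fun v hv => ?_, ?_, fun x y hxy => ?_⟩
    · by_cases hv : v = a
      · subst hv; simp
      · simp [hv]
    · have : v ≠ a := fun hva => hv (hva ▸ ha)
      simp [this]
    · simp [Finset.sum_pi_single', ha]
    · by_cases hx : x = a
      · right
        have : y ≠ a := fun hy => hxy.ne (hx.trans hy.symm)
        simp [this]
      · left; simp [hx]
  rw [contractible_iff_id_nullhomotopic]
  refine ⟨⟨_, hmem⟩, homotopic_of_segment_subset _ _ fun w => ?_⟩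
  refine segment_subset_indepSpace w.2 hmem fun x y hxy => ?_
  by_cases hx : x = a
  · subst hx
    right
    have hy : y ∉ S := fun hy => h y hy hxy
    exact ⟨w.2.2.1 y hy, by simp [hxy.ne']⟩
  · by_cases hy : y = a
    · subst hy
      have hx' : x ∉ S := fun hx' => h x hx' hxy.symm
      exact Or.inl ⟨w.2.2.1 x hx', by simp [hx]⟩
    · rcases w.2.2.2.2 x y hxy with h0 | h0
      · exact Or.inl ⟨h0, by simp [hx]⟩
      · exact Or.inr ⟨h0, by simp [hy]⟩

/-- Move the weight of the vertex `v` to the vertex `u`. -/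
def moveWeight [DecidableEq V] (u v : V) (w : V → ℝ) : V → ℝ :=
  fun x => if x = v then 0 else if x = u then w u + w v else w x

theorem moveWeight_eq_self [DecidableEq V] (u v : V) {w : V → ℝ} (h : w v = 0) :
    moveWeight u v w = w := by
  funext x
  unfold moveWeight
  split_ifs with h1 h2
  · rw [h1, h]
  · rw [h2, h, add_zero]
  · rfl

theorem continuous_moveWeight [DecidableEq V] (u v : V) : Continuous (moveWeight u v) := by
  refine continuous_pi fun x => ?_
  unfold moveWeight
  split_ifs <;> fun_prop

/-- If `w v ≠ 0`, every neighbour of `v` has weight zero, hence so does every neighbour of `u`. Thus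
`u` can be added to the support of `w`, and this larger face contains the moved point as well. -/
theorem moveWeight_common_face [DecidableEq V] {G : SimpleGraph V} {S : Finset V} {u v : V}
    (hv : v ∈ S) (h : ∀ x ∈ S, G.Adj u x → G.Adj v x) {w : V → ℝ} (hw : w ∈ indepSpace G S)
    (x y : V) (hxy : G.Adj x y) :
    (w x = 0 ∧ moveWeight u v w x = 0) ∨ (w y = 0 ∧ moveWeight u v w y = 0) := by
  by_cases hwv : w v = 0
  · rw [moveWeight_eq_self u v hwv]
    simpa using hw.2.2.2 x y hxy
  have hv0 : ∀ z, G.Adj v z → w z = 0 := fun z hz => (hw.2.2.2 v z hz).resolve_left hwv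
  have hu0 : ∀ z, G.Adj u z → w z = 0 := fun z hz => by
    by_cases hzS : z ∈ S
    · exact hv0 z (h z hzS hz)
    · exact hw.2.1 z hzS
  -- An edge from `u` to `v` would make `v` a neighbour of itself by `h`.
  have huv : ¬ G.Adj u v := fun huv => G.loopless.irrefl v (h v hv huv)
  have key : ∀ a b, G.Adj a b → (a = u ∨ a = v) → w b = 0 ∧ moveWeight u v w b = 0 := by
    intro a b hab ha
    have hb : w b = 0 := by
      rcases ha with rfl | rfl
      · exact hu0 b hab
      · exact hv0 b hab
    have hbu : b ≠ u := by
      rintro rfl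
      rcases ha with rfl | rfl
      · exact hab.ne rfl
      · exact huv hab.symm
    refine ⟨hb, ?_⟩
    unfold moveWeight
    rw [if_neg hbu, hb, ite_self]
  by_cases hx : x = u ∨ x = v
  · exact Or.inr (key x y hxy hx)
  by_cases hy : y = u ∨ y = v
  · exact Or.inl (key y x hxy.symm hy)
  push Not at hx hy
  simpa [moveWeight, hx.1, hx.2, hy.1, hy.2] using hw.2.2.2 x y hxy

theorem moveWeight_mem [DecidableEq V] {G : SimpleGraph V} {S : Finset V} {u v : V}
    (hu : u ∈ S) (hv : v ∈ S) (huv : u ≠ v) (h : ∀ x ∈ S, G.Adj u x → G.Adj v x) {w : V → ℝ}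
    (hw : w ∈ indepSpace G S) : moveWeight u v w ∈ indepSpace G (S.erase v) := by
  refine ⟨fun x => ?_, fun x hx => ?_, ?_, fun x y hxy => ?_⟩
  · have := hw.1 u
    have := hw.1 v
    have := hw.1 x
    unfold moveWeight
    split_ifs <;> positivity
  · unfold moveWeight
    by_cases hxv : x = v
    · rw [if_pos hxv]
    · have hxS : x ∉ S := fun hxS => hx (Finset.mem_erase.2 ⟨hxv, hxS⟩)
      have hxu : x ≠ u := fun hxu => hxS (hxu ▸ hu)
      rw [if_neg hxv, if_neg hxu, hw.2.1 x hxS]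
  · have hu' : u ∈ S.erase v := Finset.mem_erase.2 ⟨huv, hu⟩
    rw [← hw.2.2.1, ← Finset.add_sum_erase _ _ hu', ← Finset.add_sum_erase _ _ hv,
      ← Finset.add_sum_erase _ _ hu', ← add_assoc, add_comm (w v)]
    congr 1
    · simp [moveWeight, huv]
    · refine Finset.sum_congr rfl fun x hx => ?_
      simp only [Finset.mem_erase] at hx
      simp [moveWeight, hx.1, hx.2.1]
  · exact (moveWeight_common_face hv h hw x y hxy).imp And.right And.right

theorem indepSpace_erase_subset [DecidableEq V] {G : SimpleGraph V} {S : Finset V} {v : V}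
    {w : V → ℝ} (hw : w ∈ indepSpace G (S.erase v)) : w ∈ indepSpace G S := by
  have hv : w v = 0 := hw.2.1 v (Finset.notMem_erase v S)
  refine ⟨hw.1, fun x hx => hw.2.1 x fun hx' => hx (Finset.mem_of_mem_erase hx'), ?_, hw.2.2.2⟩
  rw [← hw.2.2.1, Finset.sum_erase S hv]

/-- The fold lemma: if the neighbours of `u` are neighbours of `v`, then `v` may be deleted. -/
theorem homotopyEquiv_erase [DecidableEq V] {G : SimpleGraph V} {S : Finset V} {u v : V}
    (hu : u ∈ S) (hv : v ∈ S) (huv : u ≠ v) (h : ∀ x ∈ S, G.Adj u x → G.Adj v x) :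
    Nonempty (indepSpace G S ≃ₕ indepSpace G (S.erase v)) := by
  let r : C(indepSpace G S, indepSpace G (S.erase v)) :=
    ⟨fun w => ⟨moveWeight u v w, moveWeight_mem hu hv huv h w.2⟩,
      ((continuous_moveWeight u v).comp continuous_subtype_val).subtype_mk _⟩
  let i : C(indepSpace G (S.erase v), indepSpace G S) :=
    ⟨fun w => ⟨w, indepSpace_erase_subset w.2⟩, continuous_subtype_val.subtype_mk _⟩
  -- `r` is a retraction with section `i`; by the common face property, `i ∘ r` is joined to the
  -- identity by segments.
  refine ⟨⟨r, i, ContinuousMap.Homotopic.symm ?_, ?_⟩⟩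
  · refine homotopic_of_segment_subset _ _ fun w => ?_
    exact segment_subset_indepSpace w.2 (i (r w)).2 (moveWeight_common_face hv h w.2)
  · have : r.comp i = ContinuousMap.id _ := by
      ext1 w
      exact Subtype.ext (moveWeight_eq_self u v (w.2.2.1 v (Finset.notMem_erase v S)))
    rw [this]

/-- Split the independent sets by whether they contain `v`. Removing `v` from those that do leaves
an independent set of non-neighbours of `v` and flips the sign. -/
theorem altNum_eq_sub [DecidableEq V] {G : SimpleGraph V} [DecidableRel G.Adj] {S : Finset V}
    {v : V} (hv : v ∈ S) :
    altNum G S = altNum G (S.erase v) - altNum G ((S.erase v).filter (fun x => ¬ G.Adj v x)) := by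
  classical
  have hvS : v ∉ S.erase v := Finset.notMem_erase v S
  have hins : ∀ I ⊆ S.erase v, (G.IsIndepSet ((insert v I : Finset V) : Set V) ↔
      G.IsIndepSet (I : Set V) ∧ ∀ x ∈ I, ¬ G.Adj v x) := by
    intro I hI
    rw [Finset.coe_insert, SimpleGraph.IsIndepSet, Set.pairwise_insert]
    refine and_congr_right fun _ => ⟨fun H x hx => ?_, fun H x hx _ => ?_⟩
    · exact (H x hx fun hvx => hvS (hvx ▸ hI hx)).1
    · exact ⟨H x hx, fun hxv => H x hx hxv.symm⟩
  unfold altNum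
  conv_lhs => rw [← Finset.insert_erase hv]
  rw [Finset.sum_powerset_insert hvS, sub_eq_add_neg, ← Finset.sum_neg_distrib]
  congr 1
  symm
  rw [← Finset.sum_subset (Finset.powerset_mono.2
    (Finset.filter_subset (fun x => ¬ G.Adj v x) (S.erase v)))]
  · refine Finset.sum_congr rfl fun I hI => ?_
    rw [Finset.mem_powerset] at hI
    have hI' : I ⊆ S.erase v := hI.trans (Finset.filter_subset _ _)
    have h2 : ∀ x ∈ I, ¬ G.Adj v x := fun x hx => (Finset.mem_filter.1 (hI hx)).2
    have hvI : v ∉ I := fun hvI => hvS (hI' hvI)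
    rw [Finset.card_insert_of_notMem hvI, pow_succ]
    simp only [(hins I hI').trans (and_iff_left h2)]
    split_ifs <;> simp
  · intro I hI hI2
    rw [Finset.mem_powerset] at hI hI2
    rw [if_neg]
    rw [hins I hI]
    rintro ⟨-, H⟩
    exact hI2 fun x hx => Finset.mem_filter.2 ⟨hI hx, H x hx⟩

theorem altNum_eq_zero {G : SimpleGraph V} {S : Finset V} {a : V}
    (ha : a ∈ S) (h : ∀ x ∈ S, ¬ G.Adj a x) : altNum G S = 0 := by
  classical
  rw [altNum_eq_sub ha, Finset.filter_true_of_mem, sub_self]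
  exact fun x hx => h x (Finset.mem_of_mem_erase hx)

/-- The term subtracted in the recursion at `v` vanishes: once `v` and its neighbours are gone, `u`
is isolated. -/
theorem altNum_erase [DecidableEq V] {G : SimpleGraph V} {S : Finset V} {u v : V}
    (hu : u ∈ S) (hv : v ∈ S) (huv : u ≠ v) (h : ∀ x ∈ S, G.Adj u x → G.Adj v x) :
    altNum G S = altNum G (S.erase v) := by
  classical
  rw [altNum_eq_sub hv, sub_eq_self]
  refine altNum_eq_zero (a := u) ?_ ?_
  · simp only [Finset.mem_filter, Finset.mem_erase]
    exact ⟨⟨huv, hu⟩, fun hvu => G.loopless.irrefl v (h v hv hvu.symm)⟩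
  · intro x hx hux
    simp only [Finset.mem_filter, Finset.mem_erase] at hx
    exact hx.2 (h x hx.1.2 hux)

/-- Repeated folding: the vertices of `D` are deleted in the order given by `key`. -/
theorem indepSpace_sdiff [DecidableEq V] {G : SimpleGraph V} {K : Type*} [LinearOrder K]
    (key : V → K) (S D : Finset V) (hD : D ⊆ S)
    (h : ∀ v ∈ D, ∃ u ∈ S, u ∉ D ∧ ∀ x ∈ S, G.Adj u x → G.Adj v x ∨ (x ∈ D ∧ key x < key v)) :
    Nonempty (indepSpace G S ≃ₕ indepSpace G (S \ D)) ∧ altNum G S = altNum G (S \ D) := by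
  induction hk : D.card generalizing S D with
  | zero =>
    rw [Finset.card_eq_zero] at hk
    subst hk
    rw [Finset.sdiff_empty]
    exact ⟨⟨ContinuousMap.HomotopyEquiv.refl _⟩, rfl⟩
  | succ k ih =>
    have hne : D.Nonempty := Finset.card_pos.1 (by omega)
    -- For a vertex of least key the second alternative in `hadj` is impossible, so deleting it is a
    -- genuine fold. Dominating vertices lie outside `D`, so they remain available for the later
    -- folds.
    obtain ⟨v, hv, hmin⟩ := D.exists_min_image key hne
    obtain ⟨u, hu, huD, hadj⟩ := h v hv
    have huv : u ≠ v := fun huv => huD (huv ▸ hv)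
    have hfold : ∀ x ∈ S, G.Adj u x → G.Adj v x := fun x hx hux =>
      (hadj x hx hux).resolve_right fun hx' => (hmin x hx'.1).not_gt hx'.2
    obtain ⟨⟨e⟩, hZ⟩ := ih (S.erase v) (D.erase v) (Finset.erase_subset_erase v hD)
      (fun v' hv' => by
        rw [Finset.mem_erase] at hv'
        obtain ⟨u', hu', huD', hadj'⟩ := h v' hv'.2
        refine ⟨u', Finset.mem_erase.2 ⟨fun h' => huD' (h' ▸ hv), hu'⟩,
          fun h' => huD' (Finset.mem_of_mem_erase h'), fun x hx hux => ?_⟩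
        rw [Finset.mem_erase] at hx
        exact (hadj' x hx.2 hux).imp_right fun hx' => ⟨Finset.mem_erase.2 ⟨hx.1, hx'.1⟩, hx'.2⟩)
      (by rw [Finset.card_erase_of_mem hv, hk]; rfl)
    have hset : S.erase v \ D.erase v = S \ D := by
      ext x
      simp only [Finset.mem_sdiff, Finset.mem_erase]
      by_cases hxv : x = v
      · simp [hxv, hv]
      · simp [hxv]
    rw [hset] at e hZ
    obtain ⟨e'⟩ := homotopyEquiv_erase hu (hD hv) huv hfold
    exact ⟨⟨e'.trans e⟩, (altNum_erase hu (hD hv) huv hfold).trans hZ⟩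

end General

/-! ### Matchings and cross-polytopes -/

section Matching

variable {V ι : Type*}

theorem altNum_matching [DecidableEq V] [DecidableEq ι] {G : SimpleGraph V} {p q : ι → V}
    (hinj : Function.Injective (Sum.elim p q))
    (hadj : ∀ i, G.Adj (p i) (q i))
    (honly : ∀ i, ∀ j, ¬ G.Adj (p i) (p j) ∧ ¬ G.Adj (q i) (q j) ∧ (i ≠ j → ¬ G.Adj (p i) (q j)))
    (s : Finset ι) : altNum G (s.image p ∪ s.image q) = (-1) ^ s.card := by
  classical
  have hp : Function.Injective p := hinj.comp Sum.inl_injective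
  have hq : Function.Injective q := hinj.comp Sum.inr_injective
  have hpq : ∀ i j, p i ≠ q j := fun i j hij => by
    have := @hinj (Sum.inl i) (Sum.inr j) hij
    simp at this
  induction s using Finset.induction_on with
  | empty => simp [altNum]
  | insert i s hi ih =>
    rw [Finset.card_insert_of_notMem hi, pow_succ, ← ih]
    set S := (insert i s).image p ∪ (insert i s).image q with hS
    have hmem : q i ∈ S := by simp [hS]
    -- Deleting `q i` isolates `p i`, which contributes zero; deleting `q i` together with its
    -- neighbours removes exactly the new edge, at the cost of a sign.
    rw [altNum_eq_sub hmem, altNum_eq_zero (a := p i), zero_sub, mul_neg_one]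
    · congr 2
      ext x
      simp only [hS, Finset.mem_filter, Finset.mem_erase, Finset.mem_union, Finset.mem_image,
        Finset.mem_insert]
      constructor
      · rintro ⟨⟨h1, ⟨j, hj | hj, rfl⟩ | ⟨j, hj | hj, rfl⟩⟩, h2⟩
        · subst hj
          exact absurd (hadj j).symm h2
        · exact Or.inl ⟨j, hj, rfl⟩
        · subst hj
          exact absurd rfl h1
        · exact Or.inr ⟨j, hj, rfl⟩
      · rintro (⟨j, hj, rfl⟩ | ⟨j, hj, rfl⟩)
        · have hji : j ≠ i := fun hji => hi (hji ▸ hj)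
          exact ⟨⟨hpq j i, Or.inl ⟨j, Or.inr hj, rfl⟩⟩, fun h' => (honly j i).2.2 hji h'.symm⟩
        · have hji : j ≠ i := fun hji => hi (hji ▸ hj)
          exact ⟨⟨fun h' => hji (hq h'), Or.inr ⟨j, Or.inr hj, rfl⟩⟩, (honly i j).2.1⟩
    · simp [hS, hpq]
    · intro x hx hpx
      simp only [hS, Finset.mem_erase, Finset.mem_union, Finset.mem_image] at hx
      obtain ⟨h1, ⟨j, -, rfl⟩ | ⟨j, -, rfl⟩⟩ := hx
      · exact (honly i j).1 hpx
      · exact (honly i j).2.2 (fun hij => h1 (by rw [hij])) hpx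

/-- The signed coordinates of a point of the independence complex of a matching. -/
def signedCoord (p q : ι → V) (w : V → ℝ) : EuclideanSpace ℝ ι :=
  WithLp.toLp 2 fun i => w (p i) - w (q i)

/-- The point with prescribed signed coordinates. -/
noncomputable def ofSignedCoord [DecidableEq V] [Fintype ι]
    (p q : ι → V) (y : EuclideanSpace ℝ ι) : V → ℝ := fun v =>
  (∑ i, ((if p i = v then max (y i) 0 else 0) + if q i = v then max (-y i) 0 else 0)) /
    ∑ i, |y i|

theorem sum_matching [DecidableEq V] [Fintype ι]
    {p q : ι → V} (hinj : Function.Injective (Sum.elim p q)) (w : V → ℝ) :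
    ∑ v ∈ Finset.univ.image p ∪ Finset.univ.image q, w v = ∑ i, (w (p i) + w (q i)) := by
  have hp : Function.Injective p := hinj.comp Sum.inl_injective
  have hq : Function.Injective q := hinj.comp Sum.inr_injective
  rw [Finset.sum_union, Finset.sum_image fun _ _ _ _ h => hp h,
    Finset.sum_image fun _ _ _ _ h => hq h, Finset.sum_add_distrib]
  rw [Finset.disjoint_left]
  simp only [Finset.mem_image, Finset.mem_univ, true_and]
  rintro _ ⟨i, rfl⟩ ⟨j, hj⟩
  have := @hinj (Sum.inr j) (Sum.inl i) hj
  simp at this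

theorem ofSignedCoord_left [DecidableEq V] [Fintype ι]
    {p q : ι → V} (hinj : Function.Injective (Sum.elim p q))
    (y : EuclideanSpace ℝ ι) (i : ι) :
    ofSignedCoord p q y (p i) = max (y i) 0 / ∑ j, |y j| := by
  classical
  have hp : ∀ j, p j = p i ↔ j = i := fun j => (hinj.comp Sum.inl_injective).eq_iff
  have hqp : ∀ j, q j ≠ p i := fun j hj => by
    have := @hinj (Sum.inr j) (Sum.inl i) hj
    simp at this
  simp [ofSignedCoord, hp, hqp]

theorem ofSignedCoord_right [DecidableEq V] [Fintype ι]
    {p q : ι → V} (hinj : Function.Injective (Sum.elim p q))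
    (y : EuclideanSpace ℝ ι) (i : ι) :
    ofSignedCoord p q y (q i) = max (-y i) 0 / ∑ j, |y j| := by
  classical
  have hq : ∀ j, q j = q i ↔ j = i := fun j => (hinj.comp Sum.inr_injective).eq_iff
  have hpq : ∀ j, p j ≠ q i := fun j hj => by
    have := @hinj (Sum.inl j) (Sum.inr i) hj
    simp at this
  simp [ofSignedCoord, hq, hpq]

theorem max_zero_add_max_neg (t : ℝ) : max t 0 + max (-t) 0 = |t| := by
  rcases le_total 0 t with h | h
  · rw [max_eq_left h, max_eq_right (by linarith), abs_of_nonneg h, add_zero]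
  · rw [max_eq_right h, max_eq_left (by linarith), abs_of_nonpos h, zero_add]

theorem max_zero_sub_max_neg (t : ℝ) : max t 0 - max (-t) 0 = t := by
  rcases le_total 0 t with h | h
  · rw [max_eq_left h, max_eq_right (by linarith), sub_zero]
  · rw [max_eq_right h, max_eq_left (by linarith)]; ring

theorem sum_abs_pos [Fintype ι] {y : EuclideanSpace ℝ ι} (hy : y ≠ 0) : 0 < ∑ i, |y i| := by
  obtain ⟨i, hi⟩ : ∃ i, y i ≠ 0 := by
    by_contra! h
    exact hy (by ext i; simp [h i])
  exact Finset.sum_pos' (fun _ _ => abs_nonneg _) ⟨i, Finset.mem_univ i, abs_pos.2 hi⟩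

theorem ofSignedCoord_mem [DecidableEq V] [Fintype ι] {G : SimpleGraph V} {p q : ι → V}
    (hinj : Function.Injective (Sum.elim p q))
    (honly : ∀ i, ∀ j, ¬ G.Adj (p i) (p j) ∧ ¬ G.Adj (q i) (q j) ∧ (i ≠ j → ¬ G.Adj (p i) (q j)))
    {y : EuclideanSpace ℝ ι} (hy : y ≠ 0) :
    ofSignedCoord p q y ∈ indepSpace G (Finset.univ.image p ∪ Finset.univ.image q) := by
  have hpos := sum_abs_pos hy
  have hout : ∀ v, v ∉ Finset.univ.image p ∪ Finset.univ.image q → ofSignedCoord p q y v = 0 := by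
    intro v hv
    simp only [Finset.mem_union, Finset.mem_image, Finset.mem_univ, true_and, not_or,
      not_exists] at hv
    simp [ofSignedCoord, hv.1, hv.2]
  have hzero : ∀ i, ofSignedCoord p q y (p i) = 0 ∨ ofSignedCoord p q y (q i) = 0 := by
    intro i
    rw [ofSignedCoord_left hinj, ofSignedCoord_right hinj]
    rcases le_total 0 (y i) with h | h
    · right; rw [max_eq_right (by linarith), zero_div]
    · left; rw [max_eq_right h, zero_div]
  refine ⟨fun v => ?_, hout, ?_, fun u v huv => ?_⟩
  · refine div_nonneg (Finset.sum_nonneg fun i _ => ?_) hpos.le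
    split_ifs <;> positivity
  · rw [sum_matching hinj]
    simp only [ofSignedCoord_left hinj, ofSignedCoord_right hinj, ← add_div,
      max_zero_add_max_neg]
    rw [← Finset.sum_div, div_self hpos.ne']
  · by_cases hu : u ∈ Finset.univ.image p ∪ Finset.univ.image q
    swap
    · exact Or.inl (hout u hu)
    by_cases hv : v ∈ Finset.univ.image p ∪ Finset.univ.image q
    swap
    · exact Or.inr (hout v hv)
    simp only [Finset.mem_union, Finset.mem_image, Finset.mem_univ, true_and] at hu hv
    obtain ⟨i, rfl⟩ | ⟨i, rfl⟩ := hu <;> obtain ⟨j, rfl⟩ | ⟨j, rfl⟩ := hv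
    · exact absurd huv (honly i j).1
    · obtain rfl : i = j := by
        by_contra hij
        exact (honly i j).2.2 hij huv
      exact hzero i
    · obtain rfl : j = i := by
        by_contra hij
        exact (honly j i).2.2 hij huv.symm
      exact (hzero j).symm
    · exact absurd huv (honly i j).2.1

theorem ofSignedCoord_smul [DecidableEq V] [Fintype ι]
    (p q : ι → V) {c : ℝ} (hc : 0 < c) (y : EuclideanSpace ℝ ι) :
    ofSignedCoord p q (c • y) = ofSignedCoord p q y := by
  funext v
  have h1 : ∀ t : ℝ, max (c * t) 0 = c * max t 0 := fun t => by
    rw [mul_max_of_nonneg _ _ hc.le, mul_zero]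
  have h2 : ∀ t : ℝ, max (-(c * t)) 0 = c * max (-t) 0 := fun t => by
    rw [mul_max_of_nonneg _ _ hc.le, mul_zero, mul_neg]
  simp only [ofSignedCoord, PiLp.smul_apply, smul_eq_mul, h1, h2, abs_mul, abs_of_pos hc]
  simp only [← Finset.mul_sum, ← mul_ite_zero, ← mul_add]
  exact mul_div_mul_left _ _ hc.ne'

theorem signedCoord_ofSignedCoord [DecidableEq V] [Fintype ι]
    {p q : ι → V} (hinj : Function.Injective (Sum.elim p q))
    (y : EuclideanSpace ℝ ι) :
    signedCoord p q (ofSignedCoord p q y) = (∑ i, |y i|)⁻¹ • y := by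
  ext i
  simp only [signedCoord, ofSignedCoord_left hinj, ofSignedCoord_right hinj, ← sub_div,
    max_zero_sub_max_neg, PiLp.smul_apply, smul_eq_mul]
  rw [div_eq_inv_mul]

/-- One end of each edge has weight zero, so the absolute value of a signed coordinate is the total
weight of its edge. The complex therefore lands in the `ℓ¹` unit sphere. -/
theorem sum_abs_signedCoord [DecidableEq V] [Fintype ι] {G : SimpleGraph V} {p q : ι → V}
    (hinj : Function.Injective (Sum.elim p q)) (hadj : ∀ i, G.Adj (p i) (q i)) {w : V → ℝ}
    (hw : w ∈ indepSpace G (Finset.univ.image p ∪ Finset.univ.image q)) :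
    ∑ i, |signedCoord p q w i| = 1 := by
  rw [← hw.2.2.1, sum_matching hinj]
  refine Finset.sum_congr rfl fun i _ => ?_
  change |w (p i) - w (q i)| = _
  rcases hw.2.2.2 _ _ (hadj i) with h | h
  · rw [h, zero_sub, abs_neg, abs_of_nonneg (hw.1 _), zero_add]
  · rw [h, sub_zero, abs_of_nonneg (hw.1 _), add_zero]

theorem signedCoord_ne_zero [DecidableEq V] [Fintype ι] {G : SimpleGraph V} {p q : ι → V}
    (hinj : Function.Injective (Sum.elim p q)) (hadj : ∀ i, G.Adj (p i) (q i)) {w : V → ℝ}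
    (hw : w ∈ indepSpace G (Finset.univ.image p ∪ Finset.univ.image q)) :
    signedCoord p q w ≠ 0 := by
  intro h
  have := sum_abs_signedCoord hinj hadj hw
  rw [h] at this
  simp at this

theorem ofSignedCoord_signedCoord [DecidableEq V] [Fintype ι] {G : SimpleGraph V} {p q : ι → V}
    (hinj : Function.Injective (Sum.elim p q)) (hadj : ∀ i, G.Adj (p i) (q i)) {w : V → ℝ}
    (hw : w ∈ indepSpace G (Finset.univ.image p ∪ Finset.univ.image q)) :
    ofSignedCoord p q (signedCoord p q w) = w := by
  funext v
  by_cases hv : v ∈ Finset.univ.image p ∪ Finset.univ.image q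
  · simp only [Finset.mem_union, Finset.mem_image, Finset.mem_univ, true_and] at hv
    have hi : ∀ i, signedCoord p q w i = w (p i) - w (q i) := fun i => rfl
    obtain ⟨i, rfl⟩ | ⟨i, rfl⟩ := hv
    · rw [ofSignedCoord_left hinj, sum_abs_signedCoord hinj hadj hw, div_one, hi]
      rcases hw.2.2.2 _ _ (hadj i) with h | h
      · rw [h, zero_sub, max_eq_right (neg_nonpos.2 (hw.1 _))]
      · rw [h, sub_zero, max_eq_left (hw.1 _)]
    · rw [ofSignedCoord_right hinj, sum_abs_signedCoord hinj hadj hw, div_one, hi]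
      rcases hw.2.2.2 _ _ (hadj i) with h | h
      · rw [h, zero_sub, neg_neg, max_eq_left (hw.1 _)]
      · rw [h, sub_zero, max_eq_right (neg_nonpos.2 (hw.1 _))]
  · rw [hw.2.1 v hv]
    simp only [Finset.mem_union, Finset.mem_image, Finset.mem_univ, true_and, not_or,
      not_exists] at hv
    simp [ofSignedCoord, hv.1, hv.2]

/-- The independence complex of a matching is the boundary of a cross-polytope. -/
theorem homeomorph_sphere_matching [DecidableEq V] [Fintype ι] {G : SimpleGraph V} {p q : ι → V}
    (hinj : Function.Injective (Sum.elim p q)) (hadj : ∀ i, G.Adj (p i) (q i))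
    (honly : ∀ i, ∀ j, ¬ G.Adj (p i) (p j) ∧ ¬ G.Adj (q i) (q j) ∧ (i ≠ j → ¬ G.Adj (p i) (q j))) :
    Nonempty (indepSpace G (Finset.univ.image p ∪ Finset.univ.image q) ≃ₜ
      Metric.sphere (0 : EuclideanSpace ℝ ι) 1) := by
  have hne : ∀ y : Metric.sphere (0 : EuclideanSpace ℝ ι) 1, (y : EuclideanSpace ℝ ι) ≠ 0 :=
    fun y => ne_zero_of_mem_unit_sphere y
  have hcont : Continuous (signedCoord p q) := by unfold signedCoord; fun_prop
  -- Signed coordinates identify the complex with the `ℓ¹` sphere, and radial projection carries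
  -- this to the Euclidean sphere. The inverse needs no separate rescaling, since `ofSignedCoord`
  -- divides by the `ℓ¹` norm and so is constant on open rays from the origin.
  refine ⟨{ toFun := fun w => ⟨‖signedCoord p q w‖⁻¹ • signedCoord p q w, ?_⟩
            invFun := fun y => ⟨ofSignedCoord p q y, ofSignedCoord_mem hinj honly (hne y)⟩
            left_inv := fun w => ?_
            right_inv := fun y => ?_
            continuous_toFun := ?_
            continuous_invFun := ?_ }⟩
  · have := norm_ne_zero_iff.2 (signedCoord_ne_zero hinj hadj w.2)
    rw [mem_sphere_zero_iff_norm, norm_smul, norm_inv, norm_norm, inv_mul_cancel₀ this]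
  · ext1
    have := norm_pos_iff.2 (signedCoord_ne_zero hinj hadj w.2)
    change ofSignedCoord p q (_ • signedCoord p q (w : V → ℝ)) = _
    rw [ofSignedCoord_smul p q (inv_pos.2 this), ofSignedCoord_signedCoord hinj hadj w.2]
  · ext1
    have hpos := sum_abs_pos (hne y)
    have hy : ‖(y : EuclideanSpace ℝ ι)‖ = 1 := mem_sphere_zero_iff_norm.1 y.2
    simp only [signedCoord_ofSignedCoord hinj]
    rw [norm_smul, hy, mul_one, smul_smul, norm_inv, inv_inv, Real.norm_of_nonneg hpos.le,
      mul_inv_cancel₀ hpos.ne', one_smul]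
  · have h1 : Continuous fun w : indepSpace G (Finset.univ.image p ∪ Finset.univ.image q) =>
        signedCoord p q w := hcont.comp continuous_subtype_val
    refine Continuous.subtype_mk (Continuous.smul (h1.norm.inv₀ fun w => ?_) h1) _
    exact norm_ne_zero_iff.2 (signedCoord_ne_zero hinj hadj w.2)
  · refine Continuous.subtype_mk (continuous_pi fun v => ?_) _
    unfold ofSignedCoord
    refine Continuous.div ?_ ?_ fun y => (sum_abs_pos (hne y)).ne'
    · refine continuous_finsetSum _ fun i _ => Continuous.add ?_ ?_
      · split_ifs <;> fun_prop
      · split_ifs <;> fun_prop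
    · fun_prop

end Matching

/-! ### Passage from an induced subgraph to a finite vertex set of the ambient graph -/

section Induce

variable {V : Type*}

open Classical in
/-- Extension by zero is a homeomorphism from the realization of the independence complex of an
induced subgraph. -/
theorem homeomorph_realization_induce (G : SimpleGraph V) (s : Set V) [Fintype s] (S : Finset V)
    (hS : ∀ v, v ∈ S ↔ v ∈ s) :
    Nonempty (realization (indepComplex (G.induce s)) ≃ₜ indepSpace G S) := by
  have hsum : ∀ w : V → ℝ, ∑ v : s, w v = ∑ v ∈ S, w v := fun w =>
    Finset.sum_bij (fun v _ => v.1) (fun v _ => (hS _).2 v.2) (fun _ _ _ _ h => Subtype.ext h)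
      (fun v hv => ⟨⟨v, (hS v).1 hv⟩, Finset.mem_univ _, rfl⟩) fun _ _ => rfl
  let ext0 : (s → ℝ) → V → ℝ := fun w v => if h : v ∈ s then w ⟨v, h⟩ else 0
  have hext : ∀ w (v : s), ext0 w v = w v := fun w v => by simp [ext0]
  refine ⟨{ toFun := fun w => ⟨ext0 w, ?_⟩
            invFun := fun w => ⟨fun v => w.1 v, ?_⟩
            left_inv := fun w => Subtype.ext (funext fun v => hext _ v)
            right_inv := fun w => ?_
            continuous_toFun := ?_
            continuous_invFun := ?_ }⟩
  · obtain ⟨w, ⟨hw0, hw1⟩, t, ht, hsupp⟩ := w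
    refine ⟨fun v => ?_, fun v hv => ?_, ?_, fun u v huv => ?_⟩
    · by_cases h : v ∈ s
      · simpa [ext0, h] using hw0 ⟨v, h⟩
      · simp [ext0, h]
    · have h : v ∉ s := fun h => hv ((hS v).2 h)
      simp [ext0, h]
    · rw [← hsum]
      exact (Finset.sum_congr rfl fun v _ => hext w v).trans hw1
    · by_contra! hne
      have hu : u ∈ s := by
        by_contra h
        exact hne.1 (by simp [ext0, h])
      have hv : v ∈ s := by
        by_contra h
        exact hne.2 (by simp [ext0, h])
      have hut : (⟨u, hu⟩ : s) ∈ t := by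
        by_contra h
        exact hne.1 (by simpa [ext0, hu] using hsupp _ h)
      have hvt : (⟨v, hv⟩ : s) ∈ t := by
        by_contra h
        exact hne.2 (by simpa [ext0, hv] using hsupp _ h)
      exact ht.2 hut hvt (fun h => huv.ne (congrArg Subtype.val h)) huv
  -- The face required is the support of the point; it is nonempty because the weights sum to `1`.
  · refine ⟨⟨fun v => w.2.1 v, (hsum w.1).trans w.2.2.2.1⟩,
      Finset.univ.filter (fun v : s => w.1 v ≠ 0), ⟨?_, ?_⟩, fun v hv => ?_⟩
    · by_contra hempty
      rw [Finset.not_nonempty_iff_eq_empty, Finset.filter_eq_empty_iff] at hempty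
      have h1 := (hsum w.1).trans w.2.2.2.1
      rw [Finset.sum_eq_zero fun v hv => not_not.1 (hempty hv)] at h1
      exact zero_ne_one h1
    · intro u hu v hv _ huv
      simp only [Finset.coe_filter, Finset.mem_univ, true_and, Set.mem_ofPred_eq] at hu hv
      exact (w.2.2.2.2 u v huv).elim hu hv
    · simpa using hv
  · ext v
    by_cases h : v ∈ s
    · simp [ext0, h]
    · simp [ext0, h, w.2.2.1 v fun hv => h ((hS v).1 hv)]
  · refine Continuous.subtype_mk (continuous_pi fun v => ?_) _
    by_cases h : v ∈ s
    · simp only [ext0, h, dif_pos]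
      exact (continuous_apply (⟨v, h⟩ : s)).comp continuous_subtype_val
    · simp only [ext0, h, dif_neg, not_false_eq_true]
      fun_prop
  · refine Continuous.subtype_mk (continuous_pi fun v => ?_) _
    exact (continuous_apply (v : V)).comp continuous_subtype_val

theorem alternatingNumber_induce (G : SimpleGraph V) (s : Set V) [Fintype s] (S : Finset V)
    (hS : ∀ v, v ∈ S ↔ v ∈ s) : alternatingNumber (G.induce s) = altNum G S := by
  classical
  unfold alternatingNumber partitionFunction altNum
  rw [← Finset.sum_filter]
  refine Finset.sum_nbij' (fun I => I.map (Function.Embedding.subtype _))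
    (fun I => I.subtype (· ∈ s)) ?_ ?_ ?_ ?_ ?_
  · intro I hI
    simp only [Finset.mem_filter, Finset.mem_univ, true_and] at hI
    simp only [Finset.mem_filter, Finset.mem_powerset]
    refine ⟨fun v hv => ?_, ?_⟩
    · obtain ⟨v', -, rfl⟩ := Finset.mem_map.1 hv
      exact (hS _).2 v'.2
    · rintro u hu v hv huv
      obtain ⟨u', hu', rfl⟩ := Finset.mem_map.1 (Finset.mem_coe.1 hu)
      obtain ⟨v', hv', rfl⟩ := Finset.mem_map.1 (Finset.mem_coe.1 hv)
      exact hI hu' hv' fun h => huv (by rw [h])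
  · intro I hI
    simp only [Finset.mem_filter, Finset.mem_powerset] at hI
    simp only [Finset.mem_filter, Finset.mem_univ, true_and]
    intro u hu v hv huv
    simp only [Finset.mem_coe, Finset.mem_subtype] at hu hv
    exact hI.2 hu hv fun h => huv (Subtype.ext h)
  · intro I _
    ext v
    simp
  · intro I hI
    simp only [Finset.mem_filter, Finset.mem_powerset] at hI
    exact Finset.subtype_map_of_mem fun v hv => (hS v).1 (hI.1 hv)
  · intro I _
    rw [Finset.card_map]

end Induce

/-! ### Tilted rectangles in diagonal coordinates -/

section Rectangles

theorem squareLattice_adj (p q : ℤ × ℤ) : squareLattice.Adj p q ↔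
    (q.1 = p.1 + 1 ∧ q.2 = p.2) ∨ (q.1 = p.1 - 1 ∧ q.2 = p.2) ∨
    (q.1 = p.1 ∧ q.2 = p.2 + 1) ∨ (q.1 = p.1 ∧ q.2 = p.2 - 1) := by
  change |p.1 - q.1| + |p.2 - q.2| = 1 ↔ _
  rcases abs_cases (p.1 - q.1) with ⟨h1, _⟩ | ⟨h1, _⟩ <;>
    rcases abs_cases (p.2 - q.2) with ⟨h2, _⟩ | ⟨h2, _⟩ <;> rw [h1, h2] <;> omega

theorem squareLattice_adj_iff_diag (p q : ℤ × ℤ) : squareLattice.Adj p q ↔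
    (q.1 - q.2 = p.1 - p.2 + 1 ∨ q.1 - q.2 = p.1 - p.2 - 1) ∧
    (q.1 + q.2 = p.1 + p.2 + 1 ∨ q.1 + q.2 = p.1 + p.2 - 1) := by
  rw [squareLattice_adj]
  omega

/-- The points outside the residue class `2` modulo `3` in both diagonal coordinates. -/
def IsKept (e : ℤ) (p : ℤ × ℤ) : Prop := (p.1 - p.2) % 3 ≠ 2 ∧ (p.1 + p.2 - e) % 3 ≠ 2

-- Each deleted vertex is dominated by a kept vertex of its own 3×3 block with no larger diagonal
-- coordinates, hence still in the rectangle. The neighbours of the dominating vertex that are not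
-- neighbours of the deleted one lie in residue class `2`. They belong to a block with smaller
-- indices, or in one case to the same block, and must be deleted earlier.
open Classical in
theorem fold_rectangle {M N : ℕ} {e : ℤ} {S : Finset (ℤ × ℤ)}
    (hS : ∀ p : ℤ × ℤ, p ∈ S ↔ 0 ≤ p.1 - p.2 ∧ p.1 - p.2 < M ∧ 0 ≤ p.1 + p.2 - e ∧
      p.1 + p.2 - e < N) :
    Nonempty (indepSpace squareLattice S ≃ₕ indepSpace squareLattice (S.filter (IsKept e))) ∧
      altNum squareLattice S = altNum squareLattice (S.filter (IsKept e)) := by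
  have hsd : S.filter (IsKept e) = S \ S.filter (fun p => ¬ IsKept e p) := by
    ext p
    simp only [Finset.mem_filter, Finset.mem_sdiff]
    tauto
  rw [hsd]
  -- Blocks are processed lexicographically, by `b / 3` and then by `a / 3`. The last entry `b % 3`
  -- orders the two deletions at local positions `(2, 1)` and `(1, 2)` of a block of odd parity.
  refine indepSpace_sdiff (fun p : ℤ × ℤ =>
    toLex ((p.1 + p.2 - e) / 3, toLex ((p.1 - p.2) / 3, (p.1 + p.2 - e) % 3))) _ _
    (Finset.filter_subset _ _) ?_
  have main : ∀ v ∈ S.filter (fun p => ¬ IsKept e p), ∀ a b : ℤ, (a + b + e) % 2 = 0 →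
      0 ≤ a → a < M → 0 ≤ b → b < N → a % 3 ≠ 2 → b % 3 ≠ 2 →
      -- The neighbours `(c, d)` need not be restricted to the rectangle: a coordinate `-1` has
      -- residue `2` and quotient `-1`, so it already counts as deleted in an earlier block.
      (∀ c d : ℤ, (c = a + 1 ∨ c = a - 1) → (d = b + 1 ∨ d = b - 1) →
        ((c = v.1 - v.2 + 1 ∨ c = v.1 - v.2 - 1) ∧
          (d = v.1 + v.2 - e + 1 ∨ d = v.1 + v.2 - e - 1)) ∨
        ((c % 3 = 2 ∨ d % 3 = 2) ∧ (d / 3 < (v.1 + v.2 - e) / 3 ∨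
          d / 3 = (v.1 + v.2 - e) / 3 ∧ (c / 3 < (v.1 - v.2) / 3 ∨
          c / 3 = (v.1 - v.2) / 3 ∧ d % 3 < (v.1 + v.2 - e) % 3)))) →
      ∃ u ∈ S, u ∉ S.filter (fun p => ¬ IsKept e p) ∧ ∀ x ∈ S, squareLattice.Adj u x →
        squareLattice.Adj v x ∨ (x ∈ S.filter (fun p => ¬ IsKept e p) ∧
        toLex ((x.1 + x.2 - e) / 3, toLex ((x.1 - x.2) / 3, (x.1 + x.2 - e) % 3)) <
        toLex ((v.1 + v.2 - e) / 3, toLex ((v.1 - v.2) / 3, (v.1 + v.2 - e) % 3))) := by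
    intro v hv a b hpar ha haM hb hbN ha3 hb3 h
    obtain ⟨u, hu1, hu2⟩ : ∃ u : ℤ × ℤ, u.1 - u.2 = a ∧ u.1 + u.2 - e = b :=
      ⟨((a + b + e) / 2, (b + e - a) / 2), by dsimp only; omega, by dsimp only; omega⟩
    have huS : u ∈ S := by rw [hS, hu1, hu2]; exact ⟨ha, haM, hb, hbN⟩
    have huK : IsKept e u := by rw [IsKept, hu1, hu2]; exact ⟨ha3, hb3⟩
    refine ⟨u, huS, by simp [huK], fun x hx hux => ?_⟩
    rw [squareLattice_adj_iff_diag, hu1] at hux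
    rw [squareLattice_adj_iff_diag]
    refine (h (x.1 - x.2) (x.1 + x.2 - e) hux.1 (by omega)).imp (fun h' => ⟨h'.1, by omega⟩)
      fun h' => ⟨Finset.mem_filter.2 ⟨hx, ?_⟩, ?_⟩
    · rw [IsKept]
      omega
    · simp only [Prod.Lex.toLex_lt_toLex]
      exact h'.2
  intro v hv
  have hv' := hv
  rw [Finset.mem_filter, hS, IsKept] at hv'
  obtain ⟨a, ha⟩ : ∃ a, a = v.1 - v.2 := ⟨_, rfl⟩
  obtain ⟨b, hb⟩ : ∃ b, b = v.1 + v.2 - e := ⟨_, rfl⟩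
  have hpar : (a + b + e) % 2 = 0 := by omega
  rw [← ha, ← hb] at hv'
  specialize main v hv
  rw [← ha, ← hb] at main ⊢
  clear ha hb hv
  obtain ⟨i, r, hr, rfl⟩ : ∃ i r : ℤ, (r = 0 ∨ r = 1 ∨ r = 2) ∧ a = 3 * i + r :=
    ⟨a / 3, a % 3, by omega, by omega⟩
  obtain ⟨j, s, hs, rfl⟩ : ∃ j s : ℤ, (s = 0 ∨ s = 1 ∨ s = 2) ∧ b = 3 * j + s :=
    ⟨b / 3, b % 3, by omega, by omega⟩
  have h3 : ∀ k r : ℤ, (r = 0 ∨ r = 1 ∨ r = 2) → (3 * k + r) / 3 = k := by omega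
  rw [h3 i r hr, h3 j s hs] at main ⊢
  -- In an even block the kept edge joins the local positions `(0, 0)` and `(1, 1)`. The deletable
  -- positions `(2, 0)`, `(0, 2)`, `(2, 2)` are all adjacent to `(1, 1)`, the only neighbour of `(0,
  -- 0)` not deleted earlier.
  by_cases hij : (i + j + e) % 2 = 0
  · refine main (3 * i) (3 * j) (by omega) (by omega) (by omega) (by omega) (by omega) (by omega)
      (by omega) ?_
    rintro c d (rfl | rfl) (rfl | rfl)
    · left; omega
    · right; omega
    · right; omega
    · right; omega
  -- In an odd block the deletable positions are `(1, 2)`, dominated by `(1, 0)` once `(2, 1)` is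
  -- gone, and `(2, 1)`, dominated by `(0, 1)`.
  · by_cases hs2 : s = 2
    · refine main (3 * i + 1) (3 * j) (by omega) (by omega) (by omega) (by omega) (by omega)
        (by omega) (by omega) ?_
      rintro c d (rfl | rfl) (rfl | rfl)
      · right; omega
      · right; omega
      · left; omega
      · right; omega
    · refine main (3 * i) (3 * j + 1) (by omega) (by omega) (by omega) (by omega) (by omega)
        (by omega) (by omega) ?_
      rintro c d (rfl | rfl) (rfl | rfl)
      · left; omega
      · left; omega
      · right; omega
      · right; omega

-- A kept vertex whose coordinate `a` equals `M - 1` and is divisible by `3` is isolated: `a + 1`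
-- leaves the rectangle and `a - 1` has residue `2`. The same holds for `b` and `N`.
open Classical in
theorem exists_isolated_kept {M N : ℕ} (hM : 1 ≤ M) (hN : 1 ≤ N) {e : ℤ} (he : e = 0 ∨ e = 1)
    (hne : e = 1 → ¬ (M = 1 ∧ N = 1)) (h1 : M ≡ 1 [MOD 3] ∨ N ≡ 1 [MOD 3])
    {S : Finset (ℤ × ℤ)}
    (hS : ∀ p : ℤ × ℤ, p ∈ S ↔ 0 ≤ p.1 - p.2 ∧ p.1 - p.2 < M ∧ 0 ≤ p.1 + p.2 - e ∧
      p.1 + p.2 - e < N) :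
    ∃ a ∈ S.filter (IsKept e), ∀ x ∈ S.filter (IsKept e), ¬ squareLattice.Adj a x := by
  have main : ∀ a b : ℤ, 0 ≤ a → a < M → 0 ≤ b → b < N → a % 3 ≠ 2 → b % 3 ≠ 2 →
      (a + b + e) % 2 = 0 → (a = M - 1 ∧ a % 3 = 0 ∨ b = N - 1 ∧ b % 3 = 0) →
      ∃ a ∈ S.filter (IsKept e), ∀ x ∈ S.filter (IsKept e), ¬ squareLattice.Adj a x := by
    intro a b ha haM hb hbN ha3 hb3 hpar hend
    refine ⟨((a + b + e) / 2, (b + e - a) / 2), ?_, ?_⟩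
    · simp only [Finset.mem_filter, hS, IsKept]
      omega
    · rintro ⟨x, y⟩ hx
      simp only [Finset.mem_filter, hS, IsKept, squareLattice_adj] at hx ⊢
      omega
  simp only [Nat.ModEq] at h1
  rcases h1 with h1 | h1
  -- On the last line `a = M - 1`, parity decides between `b = 0` and `b = 1`. When `N = 1` the
  -- value `b = 1` is unavailable, but then every kept vertex is isolated, and one exists because `e
  -- = 1` with `M = N = 1` is excluded.
  · by_cases hp : ((M : ℤ) - 1 + e) % 2 = 0
    · exact main (M - 1) 0 (by omega) (by omega) (by omega) (by omega) (by omega) (by omega)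
        (by omega) (by omega)
    · by_cases hN1 : N = 1
      · rcases he with rfl | rfl
        · exact main 0 0 (by omega) (by omega) (by omega) (by omega) (by omega) (by omega)
            (by omega) (by omega)
        · exact main 1 0 (by omega) (by omega) (by omega) (by omega) (by omega) (by omega)
            (by omega) (by omega)
      · exact main (M - 1) 1 (by omega) (by omega) (by omega) (by omega) (by omega) (by omega)
          (by omega) (by omega)
  · by_cases hp : ((N : ℤ) - 1 + e) % 2 = 0
    · exact main 0 (N - 1) (by omega) (by omega) (by omega) (by omega) (by omega) (by omega)
        (by omega) (by omega)
    · by_cases hM1 : M = 1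
      · rcases he with rfl | rfl
        · exact main 0 0 (by omega) (by omega) (by omega) (by omega) (by omega) (by omega)
            (by omega) (by omega)
        · exact main 0 1 (by omega) (by omega) (by omega) (by omega) (by omega) (by omega)
            (by omega) (by omega)
      · exact main 1 (N - 1) (by omega) (by omega) (by omega) (by omega) (by omega) (by omega)
          (by omega) (by omega)

/-- The lower end of the edge kept in the block `(i, j)`. -/
def lowerEnd (e i j : ℤ) : ℤ × ℤ :=
  ((3 * i + (i + j + e) % 2 + 3 * j + e) / 2, (3 * j + e - 3 * i - (i + j + e) % 2) / 2)

/-- The upper end of the edge kept in the block `(i, j)`. -/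
def upperEnd (e i j : ℤ) : ℤ × ℤ :=
  ((3 * i + 1 - (i + j + e) % 2 + 3 * j + 1 + e) / 2,
    (3 * j + 1 + e - 3 * i - 1 + (i + j + e) % 2) / 2)

-- By `hm` and `hn` the last blocks lack at most their line of residue `2`, which is deleted anyway,
-- so every one of the `m * n` blocks contributes a whole edge.
open Classical in
theorem matching_kept {M N m n : ℕ} {e : ℤ} (hm : 3 * m = M ∨ 3 * m = M + 1)
    (hn : 3 * n = N ∨ 3 * n = N + 1) {S : Finset (ℤ × ℤ)}
    (hS : ∀ p : ℤ × ℤ, p ∈ S ↔ 0 ≤ p.1 - p.2 ∧ p.1 - p.2 < M ∧ 0 ≤ p.1 + p.2 - e ∧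
      p.1 + p.2 - e < N) :
    Nonempty (indepSpace squareLattice (S.filter (IsKept e)) ≃ₕ
        Metric.sphere (0 : EuclideanSpace ℝ (Fin (m * n))) 1) ∧
      altNum squareLattice (S.filter (IsKept e)) = (-1) ^ (m * n) := by
  let f : Fin (m * n) → Fin m × Fin n := finProdFinEquiv.symm
  have hf : Function.Bijective f := finProdFinEquiv.symm.bijective
  let p : Fin (m * n) → ℤ × ℤ := fun k => lowerEnd e (f k).1 (f k).2
  let q : Fin (m * n) → ℤ × ℤ := fun k => upperEnd e (f k).1 (f k).2
  have heq : ∀ k l, ((f k).1 : ℤ) = (f l).1 → ((f k).2 : ℤ) = (f l).2 → k = l := by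
    intro k l h1 h2
    refine hf.1 (Prod.ext (Fin.ext ?_) (Fin.ext ?_))
    · exact_mod_cast h1
    · exact_mod_cast h2
  -- The term `(i + j + e) % 2` selects the diagonal of the 2×2 corner on which the parity condition
  -- holds; it also makes the halves in `lowerEnd` and `upperEnd` exact.
  have hcoord : ∀ i j : ℤ,
      (lowerEnd e i j).1 - (lowerEnd e i j).2 = 3 * i + (i + j + e) % 2 ∧
      (lowerEnd e i j).1 + (lowerEnd e i j).2 = 3 * j + e ∧
      (upperEnd e i j).1 - (upperEnd e i j).2 = 3 * i + 1 - (i + j + e) % 2 ∧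
      (upperEnd e i j).1 + (upperEnd e i j).2 = 3 * j + 1 + e := by
    intro i j
    simp only [lowerEnd, upperEnd]
    omega
  have hinj : Function.Injective (Sum.elim p q) := by
    rintro (k | k) (l | l) h
    all_goals
      simp only [Sum.elim_inl, Sum.elim_inr, p, q, Prod.ext_iff] at h
      have h1 := hcoord (f k).1 (f k).2
      have h2 := hcoord (f l).1 (f l).2
    · rw [heq k l (by omega) (by omega)]
    · omega
    · omega
    · rw [heq k l (by omega) (by omega)]
  have hadj : ∀ k, squareLattice.Adj (p k) (q k) := by
    intro k
    have h1 := hcoord (f k).1 (f k).2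
    simp only [squareLattice_adj, p, q]
    omega
  -- Two lower ends, or two upper ends, have `b` differing by a multiple of `3`, never by `±1`. A
  -- lower and an upper end can be adjacent only for equal `j`, and then the values of `a` force
  -- equal `i`.
  have honly : ∀ k, ∀ l, ¬ squareLattice.Adj (p k) (p l) ∧ ¬ squareLattice.Adj (q k) (q l) ∧
      (k ≠ l → ¬ squareLattice.Adj (p k) (q l)) := by
    intro k l
    have h1 := hcoord (f k).1 (f k).2
    have h2 := hcoord (f l).1 (f l).2
    simp only [squareLattice_adj, p, q]
    refine ⟨by omega, by omega, fun hkl h => hkl (heq k l (by omega) (by omega))⟩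
  have hset : S.filter (IsKept e) = Finset.univ.image p ∪ Finset.univ.image q := by
    ext v
    simp only [Finset.mem_filter, hS, IsKept, Finset.mem_union, Finset.mem_image,
      Finset.mem_univ, true_and, p, q]
    constructor
    · rintro ⟨⟨h1, h2, h3, h4⟩, h5, h6⟩
      obtain ⟨i, hi⟩ : ∃ i : ℕ, (i : ℤ) = (v.1 - v.2) / 3 := ⟨((v.1 - v.2) / 3).toNat, by omega⟩
      obtain ⟨j, hj⟩ : ∃ j : ℕ, (j : ℤ) = (v.1 + v.2 - e) / 3 :=
        ⟨((v.1 + v.2 - e) / 3).toNat, by omega⟩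
      obtain ⟨k, hk⟩ := hf.2 (⟨i, by omega⟩, ⟨j, by omega⟩)
      have hc := hcoord i j
      by_cases hb : (v.1 + v.2 - e) % 3 = 0
      · refine Or.inl ⟨k, ?_⟩
        rw [hk]
        exact Prod.ext (by dsimp only; omega) (by dsimp only; omega)
      · refine Or.inr ⟨k, ?_⟩
        rw [hk]
        exact Prod.ext (by dsimp only; omega) (by dsimp only; omega)
    · rintro (⟨k, rfl⟩ | ⟨k, rfl⟩)
      all_goals
        have h1 := hcoord (f k).1 (f k).2
        have h2 := (f k).1.2
        have h3 := (f k).2.2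
        omega
  rw [hset]
  obtain ⟨φ⟩ := homeomorph_sphere_matching hinj hadj honly
  refine ⟨⟨φ.toHomotopyEquiv⟩, ?_⟩
  rw [altNum_matching hinj hadj honly, Finset.card_univ, Fintype.card_fin]

theorem three_mul_ceil_div {M m : ℕ} (hm : m = ⌈(M : ℚ) / 3⌉₊) (h : ¬ M ≡ 1 [MOD 3]) :
    3 * m = M ∨ 3 * m = M + 1 := by
  have h1 : (M : ℚ) / 3 ≤ m := hm ▸ Nat.le_ceil _
  have h2 : (m : ℚ) < M / 3 + 1 := hm ▸ Nat.ceil_lt_add_one (by positivity)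
  have h3 : M ≤ 3 * m := by
    have : (M : ℚ) ≤ 3 * m := by linarith
    exact_mod_cast this
  have h4 : 3 * m < M + 3 := by
    have : (3 * m : ℚ) < M + 3 := by linarith
    exact_mod_cast this
  simp only [Nat.ModEq] at h
  omega

theorem homotopyType_tilted_rectangle {M N : ℕ} (hM : 1 ≤ M) (hN : 1 ≤ N) {m n : ℕ}
    (hm : m = ⌈(M : ℚ) / 3⌉₊) (hn : n = ⌈(N : ℚ) / 3⌉₊) {e : ℤ} (he : e = 0 ∨ e = 1)
    (hne : e = 1 → ¬ (M = 1 ∧ N = 1)) (s : Set (ℤ × ℤ)) [Fintype s]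
    (hs : ∀ p : ℤ × ℤ, p ∈ s ↔ 0 ≤ p.1 - p.2 ∧ p.1 - p.2 < M ∧ 0 ≤ p.1 + p.2 - e ∧
      p.1 + p.2 - e < N) :
    (M ≡ 1 [MOD 3] ∨ N ≡ 1 [MOD 3] →
        ContractibleSpace (realization (indepComplex (squareLattice.induce s))) ∧
        alternatingNumber (squareLattice.induce s) = 0) ∧
      (¬ (M ≡ 1 [MOD 3] ∨ N ≡ 1 [MOD 3]) →
        Nonempty (realization (indepComplex (squareLattice.induce s)) ≃ₕ
          Metric.sphere (0 : EuclideanSpace ℝ (Fin (m * n))) 1) ∧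
        alternatingNumber (squareLattice.induce s) = (-1) ^ (m * n)) := by
  classical
  obtain ⟨φ⟩ := homeomorph_realization_induce squareLattice s s.toFinset
    fun _ => Set.mem_toFinset
  rw [alternatingNumber_induce squareLattice s s.toFinset fun _ => Set.mem_toFinset]
  have hS : ∀ p : ℤ × ℤ, p ∈ s.toFinset ↔ 0 ≤ p.1 - p.2 ∧ p.1 - p.2 < M ∧
      0 ≤ p.1 + p.2 - e ∧ p.1 + p.2 - e < N := fun p => Set.mem_toFinset.trans (hs p)
  obtain ⟨⟨ψ⟩, hZ⟩ := fold_rectangle hS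
  rw [hZ]
  refine ⟨fun h => ?_, fun h => ?_⟩
  · obtain ⟨a, ha, hiso⟩ := exists_isolated_kept hM hN he hne h hS
    have := contractibleSpace_indepSpace ha hiso
    exact ⟨(φ.toHomotopyEquiv.trans ψ).contractibleSpace, altNum_eq_zero ha hiso⟩
  · rw [not_or] at h
    obtain ⟨⟨χ⟩, hZ'⟩ := matching_kept (three_mul_ceil_div hm h.1) (three_mul_ceil_div hn h.2) hS
    exact ⟨⟨(φ.toHomotopyEquiv.trans ψ).trans χ⟩, hZ'⟩

end Rectangles

end HardSquares

open scoped ContinuousMap in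
theorem mainTheorem1 (M N : ℕ) (hM : 1 ≤ M) (hN : 1 ≤ N) (m n : ℕ)
    (hm : m = ⌈(M : ℚ) / 3⌉₊) (hn : n = ⌈(N : ℚ) / 3⌉₊) :
    ((M ≡ 1 [MOD 3] ∨ N ≡ 1 [MOD 3] →
        ContractibleSpace (HardSquares.realization (HardSquares.indepComplex
          (HardSquares.rect M N))) ∧
        HardSquares.alternatingNumber (HardSquares.rect M N) = 0) ∧
      (¬ (M ≡ 1 [MOD 3] ∨ N ≡ 1 [MOD 3]) →
        Nonempty (HardSquares.realization (HardSquares.indepComplex (HardSquares.rect M N)) ≃ₕ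
          Metric.sphere (0 : EuclideanSpace ℝ (Fin (m * n))) 1) ∧
        HardSquares.alternatingNumber (HardSquares.rect M N) = (-1) ^ (m * n))) ∧
    (¬ (M = 1 ∧ N = 1) →
      (M ≡ 1 [MOD 3] ∨ N ≡ 1 [MOD 3] →
        ContractibleSpace (HardSquares.realization (HardSquares.indepComplex
          (HardSquares.rectTilde M N))) ∧
        HardSquares.alternatingNumber (HardSquares.rectTilde M N) = 0) ∧
      (¬ (M ≡ 1 [MOD 3] ∨ N ≡ 1 [MOD 3]) →
        Nonempty (HardSquares.realization (HardSquares.indepComplex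
          (HardSquares.rectTilde M N)) ≃ₕ
          Metric.sphere (0 : EuclideanSpace ℝ (Fin (m * n))) 1) ∧
        HardSquares.alternatingNumber (HardSquares.rectTilde M N) = (-1) ^ (m * n))) := by
  refine ⟨HardSquares.homotopyType_tilted_rectangle hM hN hm hn (Or.inl rfl) (by simp) _ ?_,
    fun hne => HardSquares.homotopyType_tilted_rectangle hM hN hm hn (Or.inr rfl)
      (fun _ => hne) _ ?_⟩
  · intro p
    simp only [HardSquares.rectVerts, Set.mem_ofPred_eq]
    omega
  · intro p
    simp only [HardSquares.rectTildeVerts, Set.mem_ofPred_eq]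
    omega
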